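/- Let $G$ be a profinite group and $A$ a commutative ring. Let $\mathcal F(G)$ be the set of isomorphism classes of finite transitive discrete $G$-sets, i.e. of the $G$-sets $G/H$ with $H\le G$ open. For $T,U\in\mathcal F(G)$ write $U\le T$ if there is a $G$-map $T\to U$, let $\varphi_T(U)$ be the number of $G$-maps $T\to U$, and let $$W_T(\underline X)=\sum_{U\le T}\varphi_T(U)\,X_U^{\#T/\#U}\in\mathbf Z[X_U : U\in\mathcal F(G)]$$ be the $T$-th Witt polynomial. The Witt–Burnside ring $\mathbf W_G(A)$ is the set $\prod_{T\in\mathcal F(G)}A$ with $\mathbf a+\mathbf b=(S_T(\mathbf a,\mathbf b))_T$ and $\mathbf a\cdot\mathbf b=(M_T(\mathbf a,\mathbf b))_T$, where $S_T,M_T\in\mathbf Z[\underline X,\underline Y]$ are the unique families of polynomials with $W_T(\underline S)=W_T(\underline X)+W_T(\underline Y)$ and $W_T(\underline M)=W_T(\underline X)W_T(\underline Y)$ for all $T$. For $n\ge 1$ let $I_n=\{\mathbf a\in\mathbf W_G(A): a_T=0\text{ whenever }\#T<n\}$, and for an open normal subgroup $N$ of $G$ let $K_N=\{\mathbf a\in\mathbf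 W_G(A): a_T=0\text{ whenever }N\text{ acts trivially on }T\}$; these are ideals of $\mathbf W_G(A)$. The initial vanishing topology on $\mathbf W_G(A)$ is the one in which a set $\mathcal O$ is open if and only if for each $\mathbf a\in\mathcal O$ there is $n\ge1$ with $\mathbf a+I_n\subseteq\mathcal O$. The profinite topology on $\mathbf W_G(A)$ is the one induced by the map $\mathbf W_G(A)\to\prod_N\mathbf W_G(A)/K_N$, where $N$ runs over the open normal subgroups of $G$ and every factor is discrete. Both make $\mathbf W_G(A)$ a topological additive group. **Theorem.** (1) $\mathbf W_G(A)$ is Hausdorff and complete in the initial vanishing topology: every Cauchy net (equivalently, Cauchy filter) converges. (2) $\mathbf W_G(A)$ is Hausdorff and complete in the profinite topology. -/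

import Mathlib

open scoped Classical in
theorem WittBurnside.card_dvd_sum_stabilizer {Q Z R : Type*} [Group Q] [Finite Q] [Fintype Z]
    [MulAction Q Z] [CommRing R] (d : Z → R) (hd : ∀ (q : Q) z, d (q • z) = d z) :
    (Nat.card Q : R) ∣ ∑ z, (Nat.card (MulAction.stabilizer Q z) : R) * d z := by
  rw [← Finset.sum_fiberwise (s := Finset.univ)
    (g := fun z => (Quotient.mk (MulAction.orbitRel Q Z) z))]
  refine Finset.dvd_sum fun w _ => ?_
  induction w using Quotient.inductionOn with
  | h z0 =>
    have h1 : ∀ z ∈ Finset.univ.filter (fun z => (Quotient.mk (MulAction.orbitRel Q Z) z)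
        = Quotient.mk (MulAction.orbitRel Q Z) z0),
        (Nat.card (MulAction.stabilizer Q z) : R) * d z
          = (Nat.card (MulAction.stabilizer Q z0) : R) * d z0 := by
      intro z hz
      obtain ⟨q, rfl⟩ : z ∈ MulAction.orbit Q z0 :=
        MulAction.orbitRel_apply.mp (Quotient.exact (Finset.mem_filter.mp hz).2)
      simp only [hd]
      rw [Nat.card_congr (MulAction.stabilizerEquivStabilizer (g := q) rfl).toEquiv.symm]
    rw [Finset.sum_congr rfl h1, Finset.sum_const, nsmul_eq_mul, ← mul_assoc]
    refine Dvd.dvd.mul_right (dvd_of_eq ?_) _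
    rw [← Nat.cast_mul]
    congr 1
    have h2 : Finset.card (Finset.univ.filter (fun z => (Quotient.mk (MulAction.orbitRel Q Z) z)
        = Quotient.mk (MulAction.orbitRel Q Z) z0)) = Nat.card (MulAction.orbit Q z0) := by
      rw [← Set.ncard_coe_finset, ← Nat.card_coe_set_eq]
      congr 2
      ext z
      simp only [Finset.coe_filter, Finset.mem_univ, true_and, Set.mem_ofPred_eq]
      rw [Quotient.eq]
      exact MulAction.orbitRel_apply
    rw [h2, ← Nat.card_prod]
    exact Nat.card_congr (MulAction.orbitProdStabilizerEquivGroup Q z0).symm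

open scoped Classical in
theorem WittBurnside.monomial_sum_pow {Q ι R : Type*} [Group Q] [Fintype Q] [Fintype ι] [CommRing R]
    (m : ι → R) (q : Q) :
    (∑ i, m i ^ orderOf q) ^ (Nat.card Q / orderOf q)
      = ∑ f : Q → ι with ∀ x, f (x * q) = f x, ∏ x, m (f x) := by
  set S := Subgroup.zpowers q
  have hS : Nat.card S = orderOf q := Nat.card_zpowers q
  have hcard : Nat.card Q / orderOf q = Fintype.card (Q ⧸ S) := by
    rw [Subgroup.card_eq_card_quotient_mul_card_subgroup S, hS,
      Nat.mul_div_cancel _ (orderOf_pos q), Nat.card_eq_fintype_card]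
  have hinv : ∀ f : Q → ι, (∀ x, f (x * q) = f x) → ∀ x y : Q, x⁻¹ * y ∈ S → f x = f y := by
    intro f hf x y hxy
    have hn : ∀ (n : ℕ) x, f (x * q ^ n) = f x := by
      intro n
      induction n with
      | zero => simp
      | succ n ih => intro x; rw [pow_succ, ← mul_assoc, hf, ih]
    obtain ⟨n, hn'⟩ := (mem_powers_iff_mem_zpowers (x := q)).mpr hxy
    have := hn n x
    simp only at hn'
    rw [hn', mul_inv_cancel_left] at this
    exact this.symm
  have h1 : (∑ i, m i ^ orderOf q) ^ (Nat.card Q / orderOf q)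
      = ∑ g : (Q ⧸ S) → ι, ∏ c, m (g c) ^ orderOf q := by
    rw [hcard, ← Finset.card_univ, ← Finset.prod_const, Finset.prod_univ_sum]
    simp
  rw [h1]
  refine Finset.sum_bij' (fun g _ => fun x => g (QuotientGroup.mk x))
    (fun f _ => fun c => f c.out) ?_ ?_ ?_ ?_ ?_
  · intro g _
    simp only [Finset.mem_filter, Finset.mem_univ, true_and]
    intro x
    congr 1
    rw [QuotientGroup.eq]
    simp [S]
  · simp
  · intro g _
    funext c
    simp
  · intro f hf
    funext x
    simp only [Finset.mem_filter, Finset.mem_univ, true_and] at hf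
    refine hinv f hf _ _ ?_
    rw [← QuotientGroup.eq]
    simp
  · intro g _
    rw [← Equiv.prod_comp (Subgroup.groupEquivQuotientProdSubgroup (s := S)).symm,
      Fintype.prod_prod_type]
    refine Finset.prod_congr rfl fun c _ => ?_
    have : ∀ s : S, (QuotientGroup.mk
        ((Subgroup.groupEquivQuotientProdSubgroup (s := S)).symm (c, s)) : Q ⧸ S) = c := by
      intro s
      have h := (Subgroup.groupEquivQuotientProdSubgroup (s := S)).apply_symm_apply (c, s)
      exact congrArg Prod.fst h
    simp only [this, Finset.prod_const, Finset.card_univ]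
    rw [← hS, Nat.card_eq_fintype_card]

theorem WittBurnside.exists_monomials {σ : Type*} (n : ℕ) (hn : 0 < n) (a : MvPolynomial σ ℤ) :
    ∃ (k : ℕ) (w : Fin k → (σ →₀ ℕ)) (r : MvPolynomial σ ℤ),
      a = ∑ i, MvPolynomial.monomial (w i) 1 + (n : MvPolynomial σ ℤ) * r := by
  induction a using MvPolynomial.induction_on' with
  | monomial u c =>
    refine ⟨(c % n).toNat, fun _ => u, MvPolynomial.monomial u (c / n), ?_⟩
    have h0 : 0 ≤ c % n := Int.emod_nonneg _ (by positivity)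
    have : (n : MvPolynomial σ ℤ) = MvPolynomial.C (n : ℤ) := by simp
    rw [this, MvPolynomial.C_mul_monomial, Finset.sum_const, Finset.card_univ, Fintype.card_fin,
      ← map_nsmul, ← map_add]
    congr 1
    simp only [nsmul_eq_mul, mul_one, Int.toNat_of_nonneg h0]
    exact (Int.emod_add_mul_ediv c n).symm
  | add p q hp hq =>
    obtain ⟨k, w, r, h⟩ := hp
    obtain ⟨k', w', r', h'⟩ := hq
    refine ⟨k + k', Fin.append w w', r + r', ?_⟩
    rw [Fin.sum_univ_add]
    simp only [Fin.append_left, Fin.append_right]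
    rw [h, h']
    ring

theorem WittBurnside.card_dvd_sum_expand {Q σ : Type*} [Group Q] [Fintype Q]
    (a : MvPolynomial σ ℤ) :
    (Nat.card Q : MvPolynomial σ ℤ) ∣
      ∑ q : Q, (MvPolynomial.expand (orderOf q) a) ^ (Nat.card Q / orderOf q) := by
  classical
  obtain ⟨k, w, r, h⟩ := WittBurnside.exists_monomials (Nat.card Q) Nat.card_pos a
  let m : Fin k → MvPolynomial σ ℤ := fun i => MvPolynomial.monomial (w i) 1
  have key : (Nat.card Q : MvPolynomial σ ℤ) ∣
      ∑ q : Q, (∑ i, m i ^ orderOf q) ^ (Nat.card Q / orderOf q) := by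
    let act : MulAction Q (Q → Fin k) :=
      { smul := fun q f x => f (x * q)
        one_smul := fun f => funext fun x => by change f (x * 1) = f x; rw [mul_one]
        mul_smul := fun a b f => funext fun x => by
          change f (x * (a * b)) = f (x * a * b); rw [mul_assoc] }
    have hact : ∀ (q : Q) (f : Q → Fin k) x, (q • f) x = f (x * q) := fun _ _ _ => rfl
    have := WittBurnside.card_dvd_sum_stabilizer (Q := Q) (Z := Q → Fin k)
      (fun f => ∏ x, m (f x)) (fun q f => by
        simp only [hact]
        exact Equiv.prod_comp (Equiv.mulRight q) (fun x => m (f x)))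
    convert this using 1
    simp_rw [WittBurnside.monomial_sum_pow, Finset.sum_filter]
    rw [Finset.sum_comm]
    refine Finset.sum_congr rfl fun f _ => ?_
    have hs : ∀ q : Q, q ∈ MulAction.stabilizer Q f ↔ ∀ x, f (x * q) = f x := by
      intro q
      simp [MulAction.mem_stabilizer_iff, funext_iff, hact]
    trans ∑ q : Q with q ∈ MulAction.stabilizer Q f, ∏ x, m (f x)
    · rw [Finset.sum_filter]
      refine Finset.sum_congr rfl fun q _ => ?_
      by_cases h : q ∈ MulAction.stabilizer Q f
      · rw [if_pos h, if_pos ((hs q).mp h)]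
      · rw [if_neg h, if_neg (fun h' => h ((hs q).mpr h'))]
    · rw [Finset.sum_const, nsmul_eq_mul, Nat.card_eq_fintype_card, Fintype.card_subtype]
  have hexp : ∀ q : Q, MvPolynomial.expand (orderOf q) a
      = ∑ i, m i ^ orderOf q + (Nat.card Q : MvPolynomial σ ℤ) *
          MvPolynomial.expand (orderOf q) r := by
    intro q
    rw [h]
    simp [m, MvPolynomial.expand_monomial, MvPolynomial.monomial_pow]
  have hdiff : ∀ q : Q, (Nat.card Q : MvPolynomial σ ℤ) ∣
      (MvPolynomial.expand (orderOf q) a) ^ (Nat.card Q / orderOf q)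
        - (∑ i, m i ^ orderOf q) ^ (Nat.card Q / orderOf q) := by
    intro q
    refine dvd_trans ?_ (sub_dvd_pow_sub_pow _ _ _)
    rw [hexp q, add_sub_cancel_left]
    exact dvd_mul_right _ _
  have := dvd_add (Finset.dvd_sum fun q (_ : q ∈ Finset.univ) => hdiff q) key
  rwa [← Finset.sum_add_distrib, Finset.sum_congr rfl (fun q _ => sub_add_cancel _ _)] at this

open scoped Classical in
theorem WittBurnside.card_dvd_sum_fixed {Q Z σ : Type*} [Group Q] [Fintype Q] [Fintype Z]
    [MulAction Q Z] (c : Z → MvPolynomial σ ℤ) (hc : ∀ (q : Q) z, c (q • z) = c z)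
    (e : Q → Z → MvPolynomial σ ℤ)
    (he : ∀ (q : Q) z, q • z = z →
      e q z = c z ^ (Nat.card (MulAction.stabilizer Q z) / orderOf q)) :
    (Nat.card Q : MvPolynomial σ ℤ) ∣
      ∑ q : Q, MvPolynomial.expand (orderOf q) (∑ z with q • z = z, e q z) := by
  have h1 : ∀ z, ∃ d, (∑ s : MulAction.stabilizer Q z, (MvPolynomial.expand (orderOf s) (c z)) ^
      (Nat.card (MulAction.stabilizer Q z) / orderOf s))
        = (Nat.card (MulAction.stabilizer Q z) : MvPolynomial σ ℤ) * d :=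
    fun z => WittBurnside.card_dvd_sum_expand (c z)
  choose d hd using h1
  have hdinv : ∀ (q : Q) z, d (q • z) = d z := by
    intro q z
    have hne : (Nat.card (MulAction.stabilizer Q z) : MvPolynomial σ ℤ) ≠ 0 :=
      Nat.cast_ne_zero.mpr Nat.card_pos.ne'
    have E := MulAction.stabilizerEquivStabilizer (a := z) (b := q • z) (g := q) rfl
    refine mul_left_cancel₀ hne ?_
    rw [← hd z, Nat.card_congr E.toEquiv, ← hd (q • z), hc]
    rw [← Equiv.sum_comp E.toEquiv]
    refine Finset.sum_congr rfl fun s _ => ?_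
    have : orderOf (E.toEquiv s) = orderOf s := by
      exact MulEquiv.orderOf_eq E s
    rw [this]
  convert WittBurnside.card_dvd_sum_stabilizer d hdinv using 1
  simp_rw [map_sum, Finset.sum_filter]
  rw [Finset.sum_comm]
  refine Finset.sum_congr rfl fun z _ => ?_
  rw [← hd z, ← Finset.sum_filter]
  refine Finset.sum_bij' (fun q hq => ⟨q, ?_⟩) (fun s _ => (s : Q)) ?_ ?_ ?_ ?_ ?_
  · exact MulAction.mem_stabilizer_iff.mpr (Finset.mem_filter.mp hq).2
  · simp
  · intro s _
    simpa using MulAction.mem_stabilizer_iff.mp s.2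
  · simp
  · simp
  · intro q hq
    rw [he q z (Finset.mem_filter.mp hq).2, map_pow, Subgroup.orderOf_mk]

/-- Two open subgroups `H`, `K` are identified when `G / H` and `G / K` are isomorphic as
`G`-sets. Every finite transitive discrete `G`-set is isomorphic to `G / H` for an open
subgroup `H`, so the quotient is the set of isomorphism classes of such `G`-sets. -/
instance WittBurnside.frameSetoid (G : Type*) [Group G] [TopologicalSpace G] :
    Setoid (OpenSubgroup G) where
  r H K := ∃ e : (G ⧸ (H : Subgroup G)) ≃ (G ⧸ (K : Subgroup G)),
    ∀ (g : G) (x : G ⧸ (H : Subgroup G)), e (g • x) = g • e x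
  iseqv :=
    { refl := fun _ => ⟨Equiv.refl _, fun _ _ => rfl⟩
      symm := by
        rintro H K ⟨e, he⟩
        refine ⟨e.symm, fun g x => ?_⟩
        rw [Equiv.symm_apply_eq, he, Equiv.apply_symm_apply]
      trans := by
        rintro H K L ⟨e, he⟩ ⟨f, hf⟩
        refine ⟨e.trans f, fun g x => ?_⟩
        simp only [Equiv.trans_apply, he, hf] }

/-- The frame of `G`: isomorphism classes of discrete finite transitive `G`-sets. -/
abbrev WittBurnside.Frame (G : Type*) [Group G] [TopologicalSpace G] : Type _ :=
  Quotient (WittBurnside.frameSetoid G)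

namespace WittBurnside

section Frame

set_option linter.unusedSectionVars false

variable {G : Type*} [Group G] [TopologicalSpace G]

/-- A `G`-set in the isomorphism class `T`. -/
abbrev Frame.set (T : Frame G) : Type _ :=
  G ⧸ ((Quotient.out T : OpenSubgroup G) : Subgroup G)

/-- The cardinality `#T`. -/
noncomputable def Frame.size (T : Frame G) : ℕ := Nat.card T.set

/-- The number of `G`-maps from `T` to `U`. -/
noncomputable def Frame.mapCard (T U : Frame G) : ℕ := Nat.card (T.set →[G] U.set)

/-- `U ≤ T` when there is a `G`-map from `T` to `U`. -/
instance : LE (Frame G) where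
  le U T := Nonempty (T.set →[G] U.set)

theorem Frame.le_def {U T : Frame G} : U ≤ T ↔ Nonempty (T.set →[G] U.set) := Iff.rfl

/-- The class `0` of the trivial `G`-set `G / G`. -/
def Frame.trivial (G : Type*) [Group G] [TopologicalSpace G] : Frame G :=
  Quotient.mk _ (⊤ : OpenSubgroup G)

theorem Frame.map_surjective {T U : Frame G} (f : T.set →[G] U.set) : Function.Surjective f := by
  intro y
  obtain ⟨g, hg⟩ := MulAction.exists_smul_eq G (f (QuotientGroup.mk 1)) y
  exact ⟨g • QuotientGroup.mk 1, by rw [map_smul, hg]⟩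

theorem Frame.map_ext {T U : Frame G} {f h : T.set →[G] U.set} (x : T.set) (hx : f x = h x) :
    f = h := by
  ext y
  obtain ⟨g, rfl⟩ := MulAction.exists_smul_eq G x y
  rw [map_smul, map_smul, hx]

theorem Frame.eq_of_equiv {T U : Frame G} (e : T.set ≃ U.set) (he : ∀ (g : G) x, e (g • x) = g • e x) :
    T = U := by
  rw [← Quotient.out_eq T, ← Quotient.out_eq U]
  exact Quotient.sound ⟨e, he⟩

theorem Frame.exists_equiv_mk (H : OpenSubgroup G) :
    ∃ e : (G ⧸ (H : Subgroup G)) ≃ (Frame.set (Quotient.mk _ H : Frame G)),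
      ∀ (g : G) x, e (g • x) = g • e x := by
  have := Quotient.exact (Quotient.out_eq (Quotient.mk (frameSetoid G) H))
  exact Setoid.symm this

theorem Frame.exists_desc {T U V : Frame G} (p : T.set →[G] U.set) (f : T.set →[G] V.set)
    (h : ∀ x y, p x = p y → f x = f y) : ∃ k : U.set →[G] V.set, ∀ x, k (p x) = f x := by
  have hp := Frame.map_surjective p
  refine ⟨⟨fun y => f (Function.surjInv hp y), fun g y => ?_⟩, fun x => ?_⟩
  · rw [id, ← map_smul]
    apply h
    rw [Function.surjInv_eq hp, map_smul, Function.surjInv_eq hp]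
  · exact h _ _ (Function.surjInv_eq hp _)

theorem Frame.eq_of_ker {T U V : Frame G} (p : T.set →[G] U.set) (f : T.set →[G] V.set)
    (h : ∀ x y, p x = p y ↔ f x = f y) : U = V := by
  obtain ⟨k, hk⟩ := Frame.exists_desc p f fun x y => (h x y).1
  obtain ⟨l, hl⟩ := Frame.exists_desc f p fun x y => (h x y).2
  refine Frame.eq_of_equiv ⟨k, l, fun x => ?_, fun x => ?_⟩ fun g x => map_smul k g x
  · obtain ⟨y, rfl⟩ := Frame.map_surjective p x
    rw [hk, hl]
  · obtain ⟨y, rfl⟩ := Frame.map_surjective f x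
    rw [hl, hk]

theorem Frame.le_refl (T : Frame G) : T ≤ T := ⟨MulActionHom.id G⟩

theorem Frame.le_trans {T U V : Frame G} (h : T ≤ U) (h' : U ≤ V) : T ≤ V := by
  obtain ⟨f⟩ := h
  obtain ⟨f'⟩ := h'
  exact ⟨f.comp f'⟩

theorem Frame.trivial_le (T : Frame G) : Frame.trivial G ≤ T := by
  obtain ⟨e, he⟩ := Frame.exists_equiv_mk (⊤ : OpenSubgroup G)
  have hsub : ∀ x y : (Frame.trivial G).set, x = y := by
    intro x y
    obtain ⟨x, rfl⟩ := e.surjective x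
    obtain ⟨y, rfl⟩ := e.surjective y
    obtain ⟨x, rfl⟩ := QuotientGroup.mk_surjective x
    obtain ⟨y, rfl⟩ := QuotientGroup.mk_surjective y
    congr 1
    rw [QuotientGroup.eq]
    exact Subgroup.mem_top _
  exact ⟨⟨fun _ => QuotientGroup.mk 1, fun _ _ => hsub _ _⟩⟩

/-- The group of `G`-automorphisms of `T`. -/
def Frame.aut (T : Frame G) : Subgroup (Equiv.Perm T.set) where
  carrier := {e | ∀ (g : G) x, e (g • x) = g • e x}
  one_mem' := fun _ _ => rfl
  mul_mem' := fun {a b} ha hb g x => by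
    rw [Equiv.Perm.mul_apply, Equiv.Perm.mul_apply, hb, ha]
  inv_mem' := fun {a} ha g x => by
    rw [Equiv.Perm.inv_eq_iff_eq, ha]
    simp

theorem Frame.aut_smul {T : Frame G} (q : T.aut) (g : G) (x : T.set) :
    (q : Equiv.Perm T.set) (g • x) = g • (q : Equiv.Perm T.set) x := q.2 g x

theorem Frame.aut_eq_one {T : Frame G} (q : T.aut) (x : T.set)
    (h : (q : Equiv.Perm T.set) x = x) : q = 1 := by
  ext y
  obtain ⟨g, rfl⟩ := MulAction.exists_smul_eq G x y
  rw [Frame.aut_smul, h]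
  rfl

/-- Automorphisms act on maps by precomposition with the inverse. -/
noncomputable instance Frame.mapAction (T U : Frame G) : MulAction T.aut (T.set →[G] U.set) where
  smul q f := ⟨fun x => f (((q⁻¹ : T.aut) : Equiv.Perm T.set) x), fun g x => by
    rw [Frame.aut_smul, map_smul]; rfl⟩
  one_smul f := by ext x; rfl
  mul_smul a b f := by
    ext x
    change f ((((a * b)⁻¹ : T.aut) : Equiv.Perm T.set) x) =
      f (((b⁻¹ : T.aut) : Equiv.Perm T.set) (((a⁻¹ : T.aut) : Equiv.Perm T.set) x))
    rw [mul_inv_rev]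
    rfl

theorem Frame.smul_map_apply {T U : Frame G} (q : T.aut) (f : T.set →[G] U.set) (x : T.set) :
    (q • f) x = f (((q⁻¹ : T.aut) : Equiv.Perm T.set) x) := rfl

section Compact

variable [IsTopologicalGroup G]

theorem Frame.exists_quotient (T : Frame G) (q : T.aut) :
    ∃ (V : Frame G) (p : T.set →[G] V.set),
      ∀ x y, p x = p y ↔ ∃ k : ℤ, ((q ^ k : T.aut) : Equiv.Perm T.set) x = y := by
  let x0 : T.set := QuotientGroup.mk 1
  let L : Subgroup G :=
    { carrier := {g | ∃ k : ℤ, ((q ^ k : T.aut) : Equiv.Perm T.set) x0 = g • x0}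
      one_mem' := ⟨0, by simp⟩
      mul_mem' := by
        rintro a b ⟨k, hk⟩ ⟨l, hl⟩
        refine ⟨k + l, ?_⟩
        rw [add_comm, zpow_add, Subgroup.coe_mul, Equiv.Perm.mul_apply, hk, Frame.aut_smul, hl,
          mul_smul]
      inv_mem' := by
        rintro a ⟨k, hk⟩
        refine ⟨-k, ?_⟩
        rw [zpow_neg, Subgroup.coe_inv, Equiv.Perm.inv_eq_iff_eq, Frame.aut_smul, hk]
        simp }
  have hHL : ((Quotient.out T : OpenSubgroup G) : Subgroup G) ≤ L := by
    intro g hg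
    refine ⟨0, ?_⟩
    simp only [zpow_zero, OneMemClass.coe_one, Equiv.Perm.one_apply]
    change (QuotientGroup.mk 1 : T.set) = QuotientGroup.mk (g * 1)
    rw [QuotientGroup.eq]
    simpa using hg
  let L' : OpenSubgroup G :=
    ⟨L, Subgroup.isOpen_mono hHL (Quotient.out T : OpenSubgroup G).isOpen⟩
  obtain ⟨e, he⟩ := Frame.exists_equiv_mk L'
  let π : T.set → G ⧸ L := Quotient.map' id fun a b h => by
    rw [QuotientGroup.leftRel_apply] at h ⊢
    exact hHL h
  have hπ : ∀ (g : G) x, π (g • x) = g • π x := by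
    intro g x
    obtain ⟨x, rfl⟩ := QuotientGroup.mk_surjective x
    rfl
  refine ⟨Quotient.mk _ L', ⟨fun x => e (π x), fun g x => ?_⟩, fun x y => ?_⟩
  · rw [hπ]
    exact he g _
  · change e (π x) = e (π y) ↔ _
    rw [e.apply_eq_iff_eq]
    obtain ⟨a, rfl⟩ := QuotientGroup.mk_surjective x
    obtain ⟨b, rfl⟩ := QuotientGroup.mk_surjective y
    have ha : ∀ a : G, (QuotientGroup.mk a : T.set) = a • x0 := by
      intro a
      change (QuotientGroup.mk a : T.set) = QuotientGroup.mk (a * 1)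
      rw [mul_one]
    have h1 : π (QuotientGroup.mk a) = π (QuotientGroup.mk b) ↔ a⁻¹ * b ∈ L :=
      QuotientGroup.eq
    rw [h1]
    refine exists_congr fun k => ?_
    rw [ha a, ha b, Frame.aut_smul, mul_smul, eq_inv_smul_iff]

variable [CompactSpace G]

instance Frame.finite_set (T : Frame G) : Finite T.set :=
  Subgroup.quotient_finite_of_isOpen _ (Quotient.out T : OpenSubgroup G).isOpen

instance Frame.finite_map (T U : Frame G) : Finite (T.set →[G] U.set) :=
  Finite.of_injective (fun f => (f : T.set → U.set)) DFunLike.coe_injective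

theorem Frame.size_pos (T : Frame G) : 0 < T.size := Nat.card_pos

theorem Frame.finite_le (T : Frame G) : {U : Frame G | U ≤ T}.Finite := by
  let F : {U : Frame G | U ≤ T} → Setoid T.set := fun U =>
    Setoid.ker (Classical.choice (Frame.le_def.mp U.2) : T.set →[G] U.1.set)
  have : Finite (Setoid T.set) :=
    Finite.of_injective (fun s : Setoid T.set => (s.r : T.set → T.set → Prop))
      (fun s t h => Setoid.ext fun a b => iff_of_eq (congrFun (congrFun h a) b))
  refine Set.finite_coe_iff.mp (Finite.of_injective F ?_)
  rintro ⟨U, hU⟩ ⟨V, hV⟩ h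
  refine Subtype.ext (Frame.eq_of_ker (Classical.choice (Frame.le_def.mp hU))
    (Classical.choice (Frame.le_def.mp hV)) fun x y => ?_)
  exact iff_of_eq (congrArg (fun s : Setoid T.set => s x y) h)

/-- The finite set of all `U ≤ T`. -/
noncomputable def Frame.below (T : Frame G) : Finset (Frame G) := T.finite_le.toFinset

theorem Frame.mem_below {T U : Frame G} : U ∈ T.below ↔ U ≤ T := by
  simp [Frame.below]

theorem Frame.size_eq_mul {T U : Frame G} (f : T.set →[G] U.set) (u : U.set) :
    T.size = U.size * Nat.card {x // f x = u} := by
  have h : ∀ v, Nat.card {x // f x = v} = Nat.card {x // f x = u} := by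
    intro v
    obtain ⟨g, rfl⟩ := MulAction.exists_smul_eq G v u
    refine Nat.card_congr ((MulAction.toPerm g).subtypeEquiv fun x => ?_)
    rw [MulAction.toPerm_apply, map_smul]
    exact (MulAction.injective g).eq_iff.symm
  let := Fintype.ofFinite U.set
  rw [Frame.size, ← Nat.card_congr (Equiv.sigmaFiberEquiv f), Nat.card_sigma]
  simp only [h, Finset.sum_const, smul_eq_mul]
  rw [Finset.card_univ, ← Nat.card_eq_fintype_card]
  rfl

theorem Frame.card_fiber {T U : Frame G} (f : T.set →[G] U.set) (u : U.set) :
    Nat.card {x // f x = u} = T.size / U.size := by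
  rw [Frame.size_eq_mul f u, Nat.mul_div_cancel_left _ U.size_pos]

theorem Frame.size_dvd {T U : Frame G} (h : U ≤ T) : U.size ∣ T.size := by
  obtain ⟨f⟩ := h
  exact ⟨_, Frame.size_eq_mul f (QuotientGroup.mk 1)⟩

theorem Frame.eq_of_le_of_size_le {T U : Frame G} (h : U ≤ T) (hs : T.size ≤ U.size) : U = T := by
  obtain ⟨f⟩ := h
  let := Fintype.ofFinite T.set
  let := Fintype.ofFinite U.set
  have hb : Function.Bijective f := by
    rw [Fintype.bijective_iff_surjective_and_card]
    refine ⟨Frame.map_surjective f, ?_⟩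
    rw [← Nat.card_eq_fintype_card, ← Nat.card_eq_fintype_card]
    exact le_antisymm hs (Nat.card_le_card_of_surjective _ (Frame.map_surjective f))
  exact (Frame.eq_of_equiv (Equiv.ofBijective f hb) fun g x => map_smul f g x).symm

theorem Frame.size_le {T U : Frame G} (h : U ≤ T) : U.size ≤ T.size :=
  Nat.le_of_dvd T.size_pos (Frame.size_dvd h)

theorem Frame.size_lt {T U : Frame G} (h : U ≤ T) (hne : U ≠ T) : U.size < T.size :=
  lt_of_not_ge fun h' => hne (Frame.eq_of_le_of_size_le h h')

theorem Frame.mapCard_self_pos (T : Frame G) : 0 < T.mapCard T := by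
  have : Nonempty (T.set →[G] T.set) := ⟨MulActionHom.id G⟩
  exact Nat.card_pos


noncomputable instance Frame.fintype_aut (T : Frame G) : Fintype T.aut := Fintype.ofFinite _

noncomputable instance Frame.fintype_map (T U : Frame G) : Fintype (T.set →[G] U.set) :=
  Fintype.ofFinite _

theorem Frame.card_aut (T : Frame G) : Nat.card T.aut = T.mapCard T := by
  have hb : ∀ f : T.set →[G] T.set, Function.Bijective f := fun f =>
    ⟨Finite.injective_iff_surjective.mpr (Frame.map_surjective f), Frame.map_surjective f⟩
  refine Nat.card_congr
    { toFun := fun q => ⟨(q : Equiv.Perm T.set), fun g x => q.2 g x⟩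
      invFun := fun f => ⟨Equiv.ofBijective f (hb f), fun g x => map_smul f g x⟩
      left_inv := fun q => by ext x; rfl
      right_inv := fun f => by ext x; rfl }

theorem Frame.apply_of_smul_eq {T U : Frame G} {q : T.aut} {f : T.set →[G] U.set} (h : q • f = f)
    (x : T.set) : f ((q : Equiv.Perm T.set) x) = f x := by
  conv_lhs => rw [← h]
  rw [Frame.smul_map_apply]
  simp

theorem Frame.smul_eq_of_apply {T U : Frame G} {q : T.aut} {f : T.set →[G] U.set}
    (h : ∀ x, f ((q : Equiv.Perm T.set) x) = f x) : q • f = f := by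
  ext x
  rw [Frame.smul_map_apply, ← h]
  simp

theorem Frame.card_stabilizer_dvd {T U : Frame G} (f : T.set →[G] U.set)
    (S : Subgroup T.aut) (hS : S ≤ MulAction.stabilizer T.aut f) :
    Nat.card S ∣ T.size / U.size := by
  let u : U.set := QuotientGroup.mk 1
  rw [← Frame.card_fiber f u]
  let Z := {x // f x = u}
  let := Fintype.ofFinite Z
  let act : MulAction S Z :=
    { smul := fun s z => ⟨((s : T.aut) : Equiv.Perm T.set) z.1, by
        rw [Frame.apply_of_smul_eq (MulAction.mem_stabilizer_iff.mp (hS s.2))]; exact z.2⟩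
      one_smul := fun z => rfl
      mul_smul := fun a b z => rfl }
  have h := card_dvd_sum_stabilizer (Q := S) (Z := Z) (R := ℤ) (fun _ => 1) fun _ _ => rfl
  have h1 : ∀ z : Z, Nat.card (MulAction.stabilizer S z) = 1 := by
    intro z
    rw [Subgroup.card_eq_one, Subgroup.eq_bot_iff_forall]
    intro s hs
    have : ((s : T.aut) : Equiv.Perm T.set) z.1 = z.1 :=
      congrArg Subtype.val (MulAction.mem_stabilizer_iff.mp hs)
    exact Subtype.ext (Frame.aut_eq_one _ _ this)
  simp only [h1, Nat.cast_one, mul_one, Finset.sum_const, nsmul_eq_mul, Finset.card_univ] at h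
  rw [Nat.card_eq_fintype_card (α := Z)]
  exact_mod_cast h

/-- The quotient of `T` by the cyclic group generated by an automorphism. -/
noncomputable def Frame.quo (T : Frame G) (q : T.aut) : Frame G := (T.exists_quotient q).choose

theorem Frame.quo_spec (T : Frame G) (q : T.aut) : ∃ (p : T.set →[G] (T.quo q).set),
      ∀ x y, p x = p y ↔ ∃ k : ℤ, ((q ^ k : T.aut) : Equiv.Perm T.set) x = y :=
  (T.exists_quotient q).choose_spec

theorem Frame.quo_le (T : Frame G) (q : T.aut) : T.quo q ≤ T := ⟨(T.quo_spec q).choose⟩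

theorem Frame.size_quo (T : Frame G) (q : T.aut) : T.size = (T.quo q).size * orderOf q := by
  obtain ⟨p, hp⟩ := T.quo_spec q
  let x0 : T.set := QuotientGroup.mk 1
  rw [Frame.size_eq_mul p (p x0), ← Nat.card_zpowers]
  congr 1
  symm
  refine Nat.card_congr (Equiv.ofBijective
    (fun s : Subgroup.zpowers q => ⟨((s : T.aut) : Equiv.Perm T.set) x0, ?_⟩) ⟨?_, ?_⟩)
  · obtain ⟨k, hk⟩ := s.2
    symm
    rw [hp]
    exact ⟨k, by rw [← hk]⟩
  · intro s t h
    have h' := congrArg Subtype.val h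
    simp only at h'
    have : (t : T.aut)⁻¹ * s = 1 := by
      refine Frame.aut_eq_one _ x0 ?_
      rw [Subgroup.coe_mul, Subgroup.coe_inv, Equiv.Perm.mul_apply, Equiv.Perm.inv_eq_iff_eq]
      exact h'
    exact Subtype.ext (inv_mul_eq_one.mp this).symm
  · rintro ⟨y, hy⟩
    obtain ⟨k, hk⟩ := (hp x0 y).mp hy.symm
    exact ⟨⟨q ^ k, k, rfl⟩, Subtype.ext hk⟩

theorem Frame.quo_one (T : Frame G) : T.quo 1 = T :=
  Frame.eq_of_le_of_size_le (T.quo_le 1) (by rw [T.size_quo 1, orderOf_one, mul_one])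

theorem Frame.size_quo_lt (T : Frame G) (q : T.aut) (hq : q ≠ 1) : (T.quo q).size < T.size := by
  have h1 : 1 < orderOf q := by
    have := orderOf_pos q
    have h2 : orderOf q ≠ 1 := fun h => hq (orderOf_eq_one_iff.mp h)
    omega
  have := T.size_quo q
  have := (T.quo q).size_pos
  nlinarith

open scoped Classical in
theorem Frame.mapCard_quo (T U : Frame G) (q : T.aut) :
    (T.quo q).mapCard U = Finset.card {f : T.set →[G] U.set | q • f = f} := by
  obtain ⟨p, hp⟩ := T.quo_spec q
  rw [← Fintype.card_subtype, ← Nat.card_eq_fintype_card]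
  refine Nat.card_congr (Equiv.ofBijective (fun k => ⟨k.comp p, ?_⟩) ⟨?_, ?_⟩)
  · refine Frame.smul_eq_of_apply fun x => ?_
    rw [MulActionHom.comp_apply, MulActionHom.comp_apply]
    congr 1
    symm
    rw [hp]
    exact ⟨1, by simp⟩
  · intro k l h
    have h' := congrArg Subtype.val h
    ext y
    obtain ⟨x, rfl⟩ := Frame.map_surjective p y
    exact DFunLike.congr_fun h' x
  · rintro ⟨f, hf⟩
    obtain ⟨k, hk⟩ := Frame.exists_desc p f fun x y hxy => by
      obtain ⟨n, rfl⟩ := (hp x y).mp hxy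
      have : (q ^ n) • f = f := by
        have : q ^ n ∈ MulAction.stabilizer T.aut f :=
          Subgroup.zpow_mem _ (MulAction.mem_stabilizer_iff.mpr hf) n
        exact MulAction.mem_stabilizer_iff.mp this
      exact (Frame.apply_of_smul_eq this x).symm
    exact ⟨k, Subtype.ext (by ext x; exact hk x)⟩

/-- The `T`-th Witt polynomial `W_T = ∑_{U ≤ T} φ_T(U) X_U ^ (#T / #U)`. -/
noncomputable def wittPoly (T : Frame G) : MvPolynomial (Frame G) ℤ :=
  ∑ U ∈ T.below, (T.mapCard U : MvPolynomial (Frame G) ℤ) * MvPolynomial.X U ^ (T.size / U.size)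

/-- The value `W_T(a)` of the `T`-th Witt polynomial at `a`. -/
noncomputable def ghost {R : Type*} [CommRing R] (a : Frame G → R) (T : Frame G) : R :=
  ∑ U ∈ T.below, (T.mapCard U : R) * a U ^ (T.size / U.size)

theorem aeval_wittPoly {R : Type*} [CommRing R] (a : Frame G → R) (T : Frame G) :
    MvPolynomial.aeval a (wittPoly T) = ghost a T := by
  simp [wittPoly, ghost]

open scoped Classical in
theorem ghost_quo {R : Type*} [CommRing R] (a : Frame G → R) (T : Frame G) (q : T.aut) :
    ghost a (T.quo q) = ∑ U ∈ T.below, ∑ _f : T.set →[G] U.set with q • _f = _f,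
      a U ^ (T.size / U.size / orderOf q) := by
  rw [ghost]
  trans ∑ U ∈ T.below, ((T.quo q).mapCard U : R) * a U ^ ((T.quo q).size / U.size)
  · refine Finset.sum_subset (fun U hU => ?_) fun U _ hU => ?_
    · exact Frame.mem_below.mpr (Frame.le_trans (Frame.mem_below.mp hU) (T.quo_le q))
    · have : (T.quo q).mapCard U = 0 := by
        rw [Frame.mem_below, Frame.le_def, not_nonempty_iff] at hU
        exact Nat.card_of_isEmpty
      rw [this, Nat.cast_zero, zero_mul]
  · refine Finset.sum_congr rfl fun U hU => ?_
    rw [Finset.sum_const, nsmul_eq_mul, Frame.mapCard_quo]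
    congr 2
    rw [Nat.div_right_comm, T.size_quo q, Nat.mul_div_cancel _ (orderOf_pos q)]

/-- The Burnside-type congruences characterising ghost vectors over `ℤ[X]`. -/
def Cong {σ : Type*} (b : Frame G → MvPolynomial σ ℤ) : Prop :=
  ∀ T : Frame G, (Nat.card T.aut : MvPolynomial σ ℤ) ∣
    ∑ q : T.aut, MvPolynomial.expand (orderOf q) (b (T.quo q))

theorem Cong.add {σ : Type*} {b c : Frame G → MvPolynomial σ ℤ} (hb : Cong b) (hc : Cong c) :
    Cong (fun T => b T + c T) := by
  intro T
  simp only [map_add, Finset.sum_add_distrib]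
  exact dvd_add (hb T) (hc T)

theorem Cong.neg {σ : Type*} {b : Frame G → MvPolynomial σ ℤ} (hb : Cong b) :
    Cong (fun T => - b T) := by
  intro T
  simp only [map_neg, Finset.sum_neg_distrib]
  exact (dvd_neg (α := MvPolynomial σ ℤ)).mpr (hb T)

theorem pow_div_aux {R : Type*} [CommRing R] (a : R) {m s o : ℕ} (hs : s ∣ m) (ho : o ∣ s)
    (ho' : 0 < o) (hs' : 0 < s) : a ^ (m / o) = (a ^ (m / s)) ^ (s / o) := by
  obtain ⟨k, rfl⟩ := hs
  obtain ⟨l, rfl⟩ := ho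
  rw [← pow_mul]
  congr 1
  rw [Nat.mul_div_cancel_left _ hs', Nat.mul_div_cancel_left _ ho', mul_assoc,
    Nat.mul_div_cancel_left _ ho', mul_comm]

theorem orderOf_dvd_stabilizer {Q Z : Type*} [Group Q] [MulAction Q Z] {q : Q} {z : Z}
    (h : q • z = z) : orderOf q ∣ Nat.card (MulAction.stabilizer Q z) := by
  have := orderOf_dvd_natCard (⟨q, MulAction.mem_stabilizer_iff.mpr h⟩ : MulAction.stabilizer Q z)
  rwa [Subgroup.orderOf_mk] at this

theorem card_stabilizer_smul {Q Z : Type*} [Group Q] [MulAction Q Z] (q : Q) (z : Z) :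
    Nat.card (MulAction.stabilizer Q (q • z)) = Nat.card (MulAction.stabilizer Q z) :=
  Nat.card_congr (MulAction.stabilizerEquivStabilizer (g := q) rfl).toEquiv.symm

theorem cong_ghost {σ : Type*} (a : Frame G → MvPolynomial σ ℤ) : Cong (ghost a) := by
  classical
  intro T
  simp only [ghost_quo, map_sum (MvPolynomial.expand _) _ T.below]
  rw [Finset.sum_comm]
  refine Finset.dvd_sum fun U _ => ?_
  refine card_dvd_sum_fixed (Q := T.aut) (Z := T.set →[G] U.set)
    (fun f => a U ^ (T.size / U.size / Nat.card (MulAction.stabilizer T.aut f)))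
    (fun q f => by simp only [card_stabilizer_smul]) (fun q _ => a U ^ (T.size / U.size / orderOf q))
    fun q f hq => ?_
  exact pow_div_aux _ (Frame.card_stabilizer_dvd f _ le_rfl) (orderOf_dvd_stabilizer hq)
    (orderOf_pos q) Nat.card_pos

theorem cong_ghost_mul {σ : Type*} (a b : Frame G → MvPolynomial σ ℤ) :
    Cong (fun T => ghost a T * ghost b T) := by
  classical
  intro T
  have key : ∀ q : T.aut, ghost a (T.quo q) * ghost b (T.quo q)
      = ∑ U ∈ T.below, ∑ V ∈ T.below,
        ∑ z : (T.set →[G] U.set) × (T.set →[G] V.set) with q • z = z,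
          a U ^ (T.size / U.size / orderOf q) * b V ^ (T.size / V.size / orderOf q) := by
    intro q
    rw [ghost_quo, ghost_quo, Finset.sum_mul_sum]
    refine Finset.sum_congr rfl fun U _ => Finset.sum_congr rfl fun V _ => ?_
    rw [Finset.sum_mul_sum, ← Finset.sum_product']
    refine Finset.sum_congr ?_ fun _ _ => rfl
    ext z
    simp [Prod.ext_iff]
  simp only [key, map_sum (MvPolynomial.expand _) _ T.below]
  rw [Finset.sum_comm]
  refine Finset.dvd_sum fun U _ => ?_
  rw [Finset.sum_comm]
  refine Finset.dvd_sum fun V _ => ?_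
  have main := card_dvd_sum_fixed (Q := T.aut) (Z := (T.set →[G] U.set) × (T.set →[G] V.set))
    (fun z => a U ^ (T.size / U.size / Nat.card (MulAction.stabilizer T.aut z)) *
      b V ^ (T.size / V.size / Nat.card (MulAction.stabilizer T.aut z)))
    (fun q z => by simp only [card_stabilizer_smul])
    (fun q _ => a U ^ (T.size / U.size / orderOf q) * b V ^ (T.size / V.size / orderOf q))
    (fun q z hq => by
      have h1 : MulAction.stabilizer T.aut z ≤ MulAction.stabilizer T.aut z.1 := fun s hs =>
        MulAction.mem_stabilizer_iff.mpr (congrArg Prod.fst (MulAction.mem_stabilizer_iff.mp hs))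
      have h2 : MulAction.stabilizer T.aut z ≤ MulAction.stabilizer T.aut z.2 := fun s hs =>
        MulAction.mem_stabilizer_iff.mpr (congrArg Prod.snd (MulAction.mem_stabilizer_iff.mp hs))
      rw [mul_pow,
        pow_div_aux (a U) (Frame.card_stabilizer_dvd z.1 _ h1) (orderOf_dvd_stabilizer hq)
          (orderOf_pos q) Nat.card_pos,
        pow_div_aux (b V) (Frame.card_stabilizer_dvd z.2 _ h2) (orderOf_dvd_stabilizer hq)
          (orderOf_pos q) Nat.card_pos])
  convert main using 7

open scoped Classical in
theorem ghost_eq {R : Type*} [CommRing R] (a : Frame G → R) (T : Frame G) :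
    ghost a T = ∑ U ∈ T.below.erase T, (T.mapCard U : R) * a U ^ (T.size / U.size)
      + (T.mapCard T : R) * a T := by
  rw [ghost, ← Finset.sum_erase_add _ _ (Frame.mem_below.mpr (Frame.le_refl T)),
    Nat.div_self T.size_pos, pow_one]

open scoped Classical in
theorem Frame.size_lt_of_mem_erase {T U : Frame G} (h : U ∈ T.below.erase T) :
    U.size < T.size :=
  Frame.size_lt (Frame.mem_below.mp (Finset.mem_of_mem_erase h)) (Finset.ne_of_mem_erase h)

open scoped Classical in
/-- Recursive solution of `W_T(a) = b_T`. -/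
noncomputable def solve {R : Type*} [CommRing R] (b : Frame G → R) (T : Frame G) : R :=
  Classical.epsilon fun c : R => (T.mapCard T : R) * c =
    b T - ∑ U ∈ (T.below.erase T).attach,
      (T.mapCard U.1 : R) * solve b U.1 ^ (T.size / U.1.size)
termination_by T.size
decreasing_by exact Frame.size_lt_of_mem_erase U.2

theorem ghost_solve {σ : Type*} (b : Frame G → MvPolynomial σ ℤ) (hb : Cong b) (T : Frame G) :
    ghost (solve b) T = b T := by
  classical
  induction h : T.size using Nat.strong_induction_on generalizing T with
  | _ n ih =>
  subst h
  set s := ∑ U ∈ T.below.erase T,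
    (T.mapCard U : MvPolynomial σ ℤ) * solve b U ^ (T.size / U.size) with hs
  have hex : ∃ c, (T.mapCard T : MvPolynomial σ ℤ) * c = b T - s := by
    obtain ⟨a', ha'⟩ : ∃ a', a' = Function.update (solve b) T 0 := ⟨_, rfl⟩
    have hq : ∀ q : T.aut, q ≠ 1 → ghost a' (T.quo q) = b (T.quo q) := by
      intro q hq
      rw [← ih _ (T.size_quo_lt q hq) _ rfl]
      refine Finset.sum_congr rfl fun U hU => ?_
      have : U ≠ T := by
        rintro rfl
        exact absurd (Frame.size_le (Frame.mem_below.mp hU)) (not_le.mpr (U.size_quo_lt q hq))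
      rw [ha', Function.update_of_ne this]
    have h1 : ghost a' T = s := by
      rw [ghost_eq, ha', Function.update_self, mul_zero, add_zero]
      refine Finset.sum_congr rfl fun U hU => ?_
      rw [Function.update_of_ne (Finset.ne_of_mem_erase hU)]
    have h2 := dvd_sub (hb T) (cong_ghost a' T)
    rw [← Finset.sum_sub_distrib, Finset.sum_eq_single 1] at h2
    · rw [Frame.quo_one, h1, orderOf_one, MvPolynomial.expand_one_apply,
        MvPolynomial.expand_one_apply, Frame.card_aut] at h2
      obtain ⟨c, hc⟩ := h2
      exact ⟨c, hc.symm⟩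
    · intro q _ hq1
      rw [hq q hq1, sub_self]
    · simp
  have hsol : (T.mapCard T : MvPolynomial σ ℤ) * solve b T = b T - s := by
    rw [hs, ← Finset.sum_attach] at hex ⊢
    have := Classical.epsilon_spec hex
    rw [solve]
    exact this
  rw [ghost_eq, hsol]
  ring

theorem ghost_injective {R : Type*} [CommRing R] [IsDomain R] [CharZero R] {a b : Frame G → R}
    (h : ∀ T, ghost a T = ghost b T) : a = b := by
  classical
  funext T
  induction hn : T.size using Nat.strong_induction_on generalizing T with
  | _ n ih =>
  subst hn
  have hT := h T
  rw [ghost_eq, ghost_eq, Finset.sum_congr rfl fun U hU => by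
    rw [ih _ (Frame.size_lt_of_mem_erase hU) U rfl]] at hT
  exact mul_left_cancel₀ (Nat.cast_ne_zero.mpr T.mapCard_self_pos.ne') (add_left_cancel hT)

theorem map_ghost {R S : Type*} [CommRing R] [CommRing S] (f : R →+* S) (a : Frame G → R)
    (T : Frame G) : f (ghost a T) = ghost (fun U => f (a U)) T := by
  simp [ghost]

theorem bind₁_wittPoly {σ : Type*} (S : Frame G → MvPolynomial σ ℤ) (T : Frame G) :
    MvPolynomial.bind₁ S (wittPoly T) = ghost S T :=
  aeval_wittPoly S T

theorem rename_wittPoly {σ : Type*} (i : Frame G → σ) (T : Frame G) :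
    MvPolynomial.rename i (wittPoly T) =
      ghost (fun U => (MvPolynomial.X (i U) : MvPolynomial σ ℤ)) T := by
  simp [wittPoly, ghost]

variable (G) in
theorem existsUnique_addPolynomial :
    ∃! S : Frame G → MvPolynomial (Frame G ⊕ Frame G) ℤ, ∀ T,
      MvPolynomial.bind₁ S (wittPoly T) =
        MvPolynomial.rename Sum.inl (wittPoly T) +
          MvPolynomial.rename Sum.inr (wittPoly T) := by
  simp only [bind₁_wittPoly, rename_wittPoly]
  refine ⟨solve _, fun T => ghost_solve _ ((cong_ghost _).add (cong_ghost _)) T, fun S hS => ?_⟩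
  refine ghost_injective fun T => ?_
  rw [hS, ghost_solve _ ((cong_ghost _).add (cong_ghost _)) T]

variable (G) in
theorem existsUnique_mulPolynomial :
    ∃! M : Frame G → MvPolynomial (Frame G ⊕ Frame G) ℤ, ∀ T,
      MvPolynomial.bind₁ M (wittPoly T) =
        MvPolynomial.rename Sum.inl (wittPoly T) *
          MvPolynomial.rename Sum.inr (wittPoly T) := by
  simp only [bind₁_wittPoly, rename_wittPoly]
  refine ⟨solve _, fun T => ghost_solve _ (cong_ghost_mul _ _) T, fun S hS => ?_⟩
  refine ghost_injective fun T => ?_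
  rw [hS, ghost_solve _ (cong_ghost_mul _ _) T]

variable (G) in
theorem existsUnique_negPolynomial :
    ∃! N : Frame G → MvPolynomial (Frame G) ℤ, ∀ T,
      MvPolynomial.bind₁ N (wittPoly T) = - wittPoly T := by
  simp only [bind₁_wittPoly]
  have h : ∀ T : Frame G, wittPoly T = ghost MvPolynomial.X T := fun T => by
    simp [wittPoly, ghost]
  simp only [h]
  refine ⟨solve _, fun T => ghost_solve _ (cong_ghost _).neg T, fun S hS => ?_⟩
  refine ghost_injective fun T => ?_
  rw [hS, ghost_solve _ (cong_ghost _).neg T]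

/-- The Witt addition polynomials: the unique integral polynomials with
`W_T(S) = W_T(X) + W_T(Y)` for all `T`. -/
noncomputable def addPolynomial : Frame G → MvPolynomial (Frame G ⊕ Frame G) ℤ :=
  (existsUnique_addPolynomial G).choose

/-- The Witt multiplication polynomials: the unique integral polynomials with
`W_T(M) = W_T(X) W_T(Y)` for all `T`. -/
noncomputable def mulPolynomial : Frame G → MvPolynomial (Frame G ⊕ Frame G) ℤ :=
  (existsUnique_mulPolynomial G).choose

/-- The polynomials describing negation. -/
noncomputable def negPolynomial : Frame G → MvPolynomial (Frame G) ℤ :=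
  (existsUnique_negPolynomial G).choose

end Compact

end Frame

end WittBurnside

/-- The underlying set `∏_{T} A` of the Witt-Burnside ring of `G` over `A`. -/
@[ext]
structure WittBurnsideRing (G : Type*) [Group G] [TopologicalSpace G] (A : Type*) where
  /-- The coordinates. -/
  coeff : WittBurnside.Frame G → A

namespace WittBurnsideRing

open WittBurnside

section Operations

set_option linter.unusedSectionVars false

variable {G : Type*} [Group G] [TopologicalSpace G] [IsTopologicalGroup G] [CompactSpace G]
  {A : Type*} [CommRing A]

noncomputable instance : Add (WittBurnsideRing G A) :=
  ⟨fun a b => ⟨fun T => MvPolynomial.aeval (Sum.elim a.coeff b.coeff) (addPolynomial T)⟩⟩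

noncomputable instance : Mul (WittBurnsideRing G A) :=
  ⟨fun a b => ⟨fun T => MvPolynomial.aeval (Sum.elim a.coeff b.coeff) (mulPolynomial T)⟩⟩

noncomputable instance : Neg (WittBurnsideRing G A) :=
  ⟨fun a => ⟨fun T => MvPolynomial.aeval a.coeff (negPolynomial T)⟩⟩

instance : Zero (WittBurnsideRing G A) := ⟨⟨fun _ => 0⟩⟩

open scoped Classical in
noncomputable instance : One (WittBurnsideRing G A) :=
  ⟨⟨fun T => if T = Frame.trivial G then 1 else 0⟩⟩

theorem coeff_add (a b : WittBurnsideRing G A) (T : Frame G) :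
    (a + b).coeff T = MvPolynomial.aeval (Sum.elim a.coeff b.coeff) (addPolynomial T) := rfl

theorem coeff_mul (a b : WittBurnsideRing G A) (T : Frame G) :
    (a * b).coeff T = MvPolynomial.aeval (Sum.elim a.coeff b.coeff) (mulPolynomial T) := rfl

theorem coeff_neg (a : WittBurnsideRing G A) (T : Frame G) :
    (-a).coeff T = MvPolynomial.aeval a.coeff (negPolynomial T) := rfl

theorem coeff_zero (T : Frame G) : (0 : WittBurnsideRing G A).coeff T = 0 := rfl

theorem ghost_add (a b : WittBurnsideRing G A) (T : Frame G) :
    ghost (a + b).coeff T = ghost a.coeff T + ghost b.coeff T := by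
  have h := congrArg (MvPolynomial.aeval (Sum.elim a.coeff b.coeff))
    ((existsUnique_addPolynomial G).choose_spec.1 T)
  rw [MvPolynomial.aeval_bind₁, map_add, MvPolynomial.aeval_rename, MvPolynomial.aeval_rename] at h
  simp only [aeval_wittPoly, Sum.elim_comp_inl, Sum.elim_comp_inr] at h
  exact h

theorem ghost_mul (a b : WittBurnsideRing G A) (T : Frame G) :
    ghost (a * b).coeff T = ghost a.coeff T * ghost b.coeff T := by
  have h := congrArg (MvPolynomial.aeval (Sum.elim a.coeff b.coeff))
    ((existsUnique_mulPolynomial G).choose_spec.1 T)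
  rw [MvPolynomial.aeval_bind₁, map_mul, MvPolynomial.aeval_rename, MvPolynomial.aeval_rename] at h
  simp only [aeval_wittPoly, Sum.elim_comp_inl, Sum.elim_comp_inr] at h
  exact h

theorem ghost_neg (a : WittBurnsideRing G A) (T : Frame G) :
    ghost (-a).coeff T = - ghost a.coeff T := by
  have h := congrArg (MvPolynomial.aeval a.coeff)
    ((existsUnique_negPolynomial G).choose_spec.1 T)
  rw [MvPolynomial.aeval_bind₁, map_neg] at h
  simp only [aeval_wittPoly] at h
  exact h

theorem ghost_of_vanish (a : Frame G → A) (T : Frame G) (h : ∀ U, U ≤ T → a U = 0) :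
    ghost a T = 0 := by
  refine Finset.sum_eq_zero fun U hU => ?_
  have hU := Frame.mem_below.mp hU
  rw [h U hU, zero_pow (Nat.div_pos (Frame.size_le hU) U.size_pos).ne', mul_zero]

theorem ghost_zero (T : Frame G) : ghost (0 : WittBurnsideRing G A).coeff T = 0 :=
  ghost_of_vanish _ _ fun _ _ => rfl

theorem ghost_one (T : Frame G) : ghost (1 : WittBurnsideRing G A).coeff T = 1 := by
  classical
  have hc : ∀ U : Frame G, (1 : WittBurnsideRing G A).coeff U =
    if U = Frame.trivial G then 1 else 0 := fun _ => rfl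
  rw [ghost, Finset.sum_eq_single (Frame.trivial G)]
  · have hsub : Subsingleton (Frame.trivial G).set := by
      obtain ⟨e, _⟩ := Frame.exists_equiv_mk (⊤ : OpenSubgroup G)
      have : Subsingleton (G ⧸ ((⊤ : OpenSubgroup G) : Subgroup G)) := by
        rw [OpenSubgroup.toSubgroup_top]
        exact QuotientGroup.subsingleton_quotient_top
      exact e.symm.injective.subsingleton
    have h1 : T.mapCard (Frame.trivial G) = 1 := by
      rw [Frame.mapCard, Nat.card_eq_one_iff_unique]
      exact ⟨⟨fun f g => by ext x; exact Subsingleton.elim _ _⟩, Frame.trivial_le T⟩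
    rw [hc, if_pos rfl, one_pow, h1, Nat.cast_one, mul_one]
  · intro U hU hne
    have hU := Frame.mem_below.mp hU
    rw [hc, if_neg hne, zero_pow (Nat.div_pos (Frame.size_le hU) U.size_pos).ne', mul_zero]
  · intro h
    exact absurd (Frame.mem_below.mpr (Frame.trivial_le T)) h

theorem eq_of_ghost {R : Type*} [CommRing R] [IsDomain R] [CharZero R]
    {a b : WittBurnsideRing G R} (h : ∀ T, ghost a.coeff T = ghost b.coeff T) : a = b :=
  WittBurnsideRing.ext (ghost_injective h)

/-- Coordinatewise application of a ring homomorphism. -/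
def mapFun {R S : Type*} [CommRing R] [CommRing S] (f : R →+* S) (a : WittBurnsideRing G R) :
    WittBurnsideRing G S := ⟨fun T => f (a.coeff T)⟩

theorem map_aeval_int {σ R S : Type*} [CommRing R] [CommRing S] (f : R →+* S) (v : σ → R)
    (p : MvPolynomial σ ℤ) :
    f (MvPolynomial.aeval v p) = MvPolynomial.aeval (fun i => f (v i)) p := by
  rw [MvPolynomial.aeval_def, MvPolynomial.aeval_def, MvPolynomial.eval₂_comp_left]
  congr 1
  exact Subsingleton.elim _ _

section mapFun

variable {R S : Type*} [CommRing R] [CommRing S] (f : R →+* S)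

theorem mapFun_add (a b : WittBurnsideRing G R) : mapFun f (a + b) = mapFun f a + mapFun f b := by
  ext T
  change f ((a + b).coeff T) = _
  rw [coeff_add, coeff_add, map_aeval_int]
  congr 2
  funext i
  cases i <;> rfl

theorem mapFun_mul (a b : WittBurnsideRing G R) : mapFun f (a * b) = mapFun f a * mapFun f b := by
  ext T
  change f ((a * b).coeff T) = _
  rw [coeff_mul, coeff_mul, map_aeval_int]
  congr 2
  funext i
  cases i <;> rfl

theorem mapFun_neg (a : WittBurnsideRing G R) : mapFun f (-a) = -mapFun f a := by
  ext T
  change f ((-a).coeff T) = _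
  rw [coeff_neg, coeff_neg, map_aeval_int]
  rfl

theorem mapFun_zero : mapFun f (0 : WittBurnsideRing G R) = 0 := by
  ext T
  exact map_zero f

theorem mapFun_one : mapFun f (1 : WittBurnsideRing G R) = 1 := by
  classical
  ext T
  change f (if T = Frame.trivial G then 1 else 0) = if T = Frame.trivial G then 1 else 0
  split_ifs
  · exact map_one f
  · exact map_zero f

end mapFun

/-- The surjection from a polynomial ring over `ℤ` used to lift identities. -/
noncomputable def cover (A : Type*) [CommRing A] : MvPolynomial A ℤ →+* A :=
  (MvPolynomial.aeval (id : A → A) : MvPolynomial A ℤ →ₐ[ℤ] A).toRingHom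

theorem exists_lift (a : WittBurnsideRing G A) :
    ∃ b : WittBurnsideRing G (MvPolynomial A ℤ), mapFun (cover A) b = a ∧
      ∀ T, a.coeff T = 0 → b.coeff T = 0 := by
  classical
  refine ⟨⟨fun T => if a.coeff T = 0 then 0 else MvPolynomial.X (a.coeff T)⟩, ?_, ?_⟩
  · ext T
    change cover A (if a.coeff T = 0 then 0 else MvPolynomial.X (a.coeff T)) = a.coeff T
    split_ifs with h
    · rw [h, map_zero]
    · simp [cover]
  · intro T h
    exact if_pos h

/-- The Witt-Burnside ring, with addition and multiplication given by the Witt addition and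
multiplication polynomials. -/
noncomputable instance : CommRing (WittBurnsideRing G A) where
  nsmul := nsmulRec
  zsmul := zsmulRec
  add_assoc a b c := by
    obtain ⟨a, rfl, -⟩ := exists_lift a
    obtain ⟨b, rfl, -⟩ := exists_lift b
    obtain ⟨c, rfl, -⟩ := exists_lift c
    simp only [← mapFun_add]
    exact congrArg _ (eq_of_ghost fun T => by simp only [ghost_add]; ring)
  zero_add a := by
    obtain ⟨a, rfl, -⟩ := exists_lift a
    rw [← mapFun_zero (cover A), ← mapFun_add]
    exact congrArg _ (eq_of_ghost fun T => by simp only [ghost_add, ghost_zero]; ring)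
  add_zero a := by
    obtain ⟨a, rfl, -⟩ := exists_lift a
    rw [← mapFun_zero (cover A), ← mapFun_add]
    exact congrArg _ (eq_of_ghost fun T => by simp only [ghost_add, ghost_zero]; ring)
  add_comm a b := by
    obtain ⟨a, rfl, -⟩ := exists_lift a
    obtain ⟨b, rfl, -⟩ := exists_lift b
    simp only [← mapFun_add]
    exact congrArg _ (eq_of_ghost fun T => by simp only [ghost_add]; ring)
  neg_add_cancel a := by
    obtain ⟨a, rfl, -⟩ := exists_lift a
    rw [← mapFun_zero (cover A), ← mapFun_neg, ← mapFun_add]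
    exact congrArg _ (eq_of_ghost fun T => by simp only [ghost_add, ghost_neg, ghost_zero]; ring)
  mul_assoc a b c := by
    obtain ⟨a, rfl, -⟩ := exists_lift a
    obtain ⟨b, rfl, -⟩ := exists_lift b
    obtain ⟨c, rfl, -⟩ := exists_lift c
    simp only [← mapFun_mul]
    exact congrArg _ (eq_of_ghost fun T => by simp only [ghost_mul]; ring)
  mul_comm a b := by
    obtain ⟨a, rfl, -⟩ := exists_lift a
    obtain ⟨b, rfl, -⟩ := exists_lift b
    simp only [← mapFun_mul]
    exact congrArg _ (eq_of_ghost fun T => by simp only [ghost_mul]; ring)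
  one_mul a := by
    obtain ⟨a, rfl, -⟩ := exists_lift a
    rw [← mapFun_one (cover A), ← mapFun_mul]
    exact congrArg _ (eq_of_ghost fun T => by simp only [ghost_mul, ghost_one]; ring)
  mul_one a := by
    obtain ⟨a, rfl, -⟩ := exists_lift a
    rw [← mapFun_one (cover A), ← mapFun_mul]
    exact congrArg _ (eq_of_ghost fun T => by simp only [ghost_mul, ghost_one]; ring)
  zero_mul a := by
    obtain ⟨a, rfl, -⟩ := exists_lift a
    rw [← mapFun_zero (cover A), ← mapFun_mul]
    exact congrArg _ (eq_of_ghost fun T => by simp only [ghost_mul, ghost_zero]; ring)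
  mul_zero a := by
    obtain ⟨a, rfl, -⟩ := exists_lift a
    rw [← mapFun_zero (cover A), ← mapFun_mul]
    exact congrArg _ (eq_of_ghost fun T => by simp only [ghost_mul, ghost_zero]; ring)
  left_distrib a b c := by
    obtain ⟨a, rfl, -⟩ := exists_lift a
    obtain ⟨b, rfl, -⟩ := exists_lift b
    obtain ⟨c, rfl, -⟩ := exists_lift c
    simp only [← mapFun_add, ← mapFun_mul]
    exact congrArg _ (eq_of_ghost fun T => by simp only [ghost_add, ghost_mul]; ring)
  right_distrib a b c := by
    obtain ⟨a, rfl, -⟩ := exists_lift a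
    obtain ⟨b, rfl, -⟩ := exists_lift b
    obtain ⟨c, rfl, -⟩ := exists_lift c
    simp only [← mapFun_add, ← mapFun_mul]
    exact congrArg _ (eq_of_ghost fun T => by simp only [ghost_add, ghost_mul]; ring)

theorem vanish_of_ghost {R : Type*} [CommRing R] [IsDomain R] [CharZero R] {P : Frame G → Prop}
    (hP : ∀ U T, U ≤ T → P T → P U) (a : Frame G → R) (h : ∀ T, P T → ghost a T = 0) :
    ∀ T, P T → a T = 0 := by
  classical
  intro T
  induction hn : T.size using Nat.strong_induction_on generalizing T with
  | _ n ih =>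
  subst hn
  intro hT
  have h1 := h T hT
  rw [ghost_eq, Finset.sum_eq_zero, zero_add] at h1
  · exact (mul_eq_zero.mp h1).resolve_left (Nat.cast_ne_zero.mpr T.mapCard_self_pos.ne')
  · intro U hU
    have hle := Frame.mem_below.mp (Finset.mem_of_mem_erase hU)
    rw [ih _ (Frame.size_lt_of_mem_erase hU) U rfl (hP U T hle hT),
      zero_pow (Nat.div_pos (Frame.size_le hle) U.size_pos).ne', mul_zero]

theorem vanish_add {P : Frame G → Prop} (hP : ∀ U T, U ≤ T → P T → P U)
    {a b : WittBurnsideRing G A} (ha : ∀ T, P T → a.coeff T = 0)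
    (hb : ∀ T, P T → b.coeff T = 0) : ∀ T, P T → (a + b).coeff T = 0 := by
  obtain ⟨a', rfl, ha'⟩ := exists_lift a
  obtain ⟨b', rfl, hb'⟩ := exists_lift b
  intro T hT
  rw [← mapFun_add]
  change cover A ((a' + b').coeff T) = 0
  have h : (a' + b').coeff T = 0 := by
    refine vanish_of_ghost hP _ (fun T hT => ?_) T hT
    rw [ghost_add, ghost_of_vanish _ _ fun U hU => ha' U (ha U (hP U T hU hT)),
      ghost_of_vanish _ _ fun U hU => hb' U (hb U (hP U T hU hT)), add_zero]
  rw [h, map_zero]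

theorem vanish_mul {P : Frame G → Prop} (hP : ∀ U T, U ≤ T → P T → P U)
    (c : WittBurnsideRing G A) {a : WittBurnsideRing G A} (ha : ∀ T, P T → a.coeff T = 0) :
    ∀ T, P T → (c * a).coeff T = 0 := by
  obtain ⟨a', rfl, ha'⟩ := exists_lift a
  obtain ⟨c', rfl, -⟩ := exists_lift c
  intro T hT
  rw [← mapFun_mul]
  change cover A ((c' * a').coeff T) = 0
  have h : (c' * a').coeff T = 0 := by
    refine vanish_of_ghost hP _ (fun T hT => ?_) T hT
    rw [ghost_mul, ghost_of_vanish a'.coeff _ fun U hU => ha' U (ha U (hP U T hU hT)), mul_zero]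
  rw [h, map_zero]

end Operations

section Topology

variable (G : Type*) [Group G] [TopologicalSpace G] [IsTopologicalGroup G] [CompactSpace G]
  (A : Type*) [CommRing A]

/-- `I_n = {a | a_T = 0 whenever #T < n}`. -/
noncomputable def initialIdeal (n : ℕ) : Ideal (WittBurnsideRing G A) where
  carrier := {a | ∀ T : Frame G, T.size < n → a.coeff T = 0}
  zero_mem' := fun _ _ => rfl
  add_mem' := fun ha hb =>
    vanish_add (fun _ _ hUT hT => lt_of_le_of_lt (Frame.size_le hUT) hT) ha hb
  smul_mem' := fun c _ ha =>
    vanish_mul (fun _ _ hUT hT => lt_of_le_of_lt (Frame.size_le hUT) hT) c ha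

theorem mem_initialIdeal {n : ℕ} {a : WittBurnsideRing G A} :
    a ∈ initialIdeal G A n ↔ ∀ T : Frame G, T.size < n → a.coeff T = 0 := Iff.rfl

/-- `K_N = {a | a_T = 0 whenever N acts trivially on T}`. -/
noncomputable def kernelIdeal (N : Subgroup G) : Ideal (WittBurnsideRing G A) where
  carrier := {a | ∀ T : Frame G, (∀ g ∈ N, ∀ x : T.set, g • x = x) → a.coeff T = 0}
  zero_mem' := fun _ _ => rfl
  add_mem' := fun ha hb => vanish_add (P := fun T => ∀ g ∈ N, ∀ x : T.set, g • x = x)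
    (fun U T hUT hT g hg x => by
      obtain ⟨f⟩ := hUT
      obtain ⟨y, rfl⟩ := Frame.map_surjective f x
      rw [← map_smul, hT g hg]) ha hb
  smul_mem' := fun c _ ha => vanish_mul (P := fun T => ∀ g ∈ N, ∀ x : T.set, g • x = x)
    (fun U T hUT hT g hg x => by
      obtain ⟨f⟩ := hUT
      obtain ⟨y, rfl⟩ := Frame.map_surjective f x
      rw [← map_smul, hT g hg]) c ha

/-- The initial vanishing topology: `O` is open when each `a ∈ O` has a coset `a + I_n`, with
`n ≥ 1`, inside `O`. -/
noncomputable abbrev initialVanishingTopology : TopologicalSpace (WittBurnsideRing G A) where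
  IsOpen O := ∀ a ∈ O, ∃ n : ℕ, 1 ≤ n ∧ ∀ b ∈ initialIdeal G A n, a + b ∈ O
  isOpen_univ := fun _ _ => ⟨1, le_rfl, fun _ _ => Set.mem_univ _⟩
  isOpen_inter := by
    rintro O P hO hP a ⟨haO, haP⟩
    obtain ⟨n, hn, h⟩ := hO a haO
    obtain ⟨m, _, h'⟩ := hP a haP
    exact ⟨max n m, le_max_of_le_left hn, fun b hb =>
      ⟨h b fun T hT => hb T (lt_max_of_lt_left hT), h' b fun T hT => hb T (lt_max_of_lt_right hT)⟩⟩
  isOpen_sUnion := by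
    rintro s hs a ⟨O, hO, ha⟩
    obtain ⟨n, hn, h⟩ := hs O hO a ha
    exact ⟨n, hn, fun b hb => ⟨O, hO, h b hb⟩⟩

theorem initialVanishing_isOpen_coset (a : WittBurnsideRing G A) (n : ℕ) (hn : 1 ≤ n) :
    @IsOpen _ (initialVanishingTopology G A) {b | b - a ∈ initialIdeal G A n} := by
  intro b hb
  refine ⟨n, hn, fun c hc => ?_⟩
  have : b + c - a = (b - a) + c := by ring
  change b + c - a ∈ initialIdeal G A n
  rw [this]
  exact Ideal.add_mem _ hb hc

theorem initialVanishing_isTopologicalAddGroup :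
    @IsTopologicalAddGroup (WittBurnsideRing G A) (initialVanishingTopology G A) _ := by
  let := initialVanishingTopology G A
  refine { continuous_add := ⟨fun O hO => ?_⟩, continuous_neg := ⟨fun O hO => ?_⟩ }
  · rw [isOpen_prod_iff]
    intro a b hab
    obtain ⟨n, hn, h⟩ := hO _ hab
    refine ⟨_, _, initialVanishing_isOpen_coset G A a n hn,
      initialVanishing_isOpen_coset G A b n hn, ?_, ?_, ?_⟩
    · change a - a ∈ initialIdeal G A n
      rw [sub_self]
      exact Ideal.zero_mem _
    · change b - b ∈ initialIdeal G A n
      rw [sub_self]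
      exact Ideal.zero_mem _
    · rintro ⟨x, y⟩ ⟨hx, hy⟩
      have := h _ (Ideal.add_mem _ hx hy)
      have e : a + b + (x - a + (y - b)) = x + y := by ring
      rw [e] at this
      exact this
  · intro a ha
    obtain ⟨n, hn, h⟩ := hO _ ha
    refine ⟨n, hn, fun b hb => ?_⟩
    have := h _ (Ideal.neg_mem_iff _ |>.mpr hb)
    have e : -a + -b = -(a + b) := by ring
    rw [e] at this
    exact this

/-- The uniform structure of the additive group with its initial vanishing topology. -/
noncomputable abbrev initialVanishingUniformSpace : UniformSpace (WittBurnsideRing G A) :=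
  @IsTopologicalAddGroup.rightUniformSpace _ _ (initialVanishingTopology G A)
    (initialVanishing_isTopologicalAddGroup G A)

/-- The profinite topology: the topology induced by the map into the product of the discrete
rings `W_G(A) / K_N`, for `N` ranging over the open normal subgroups of `G`. -/
noncomputable abbrev profiniteTopology : TopologicalSpace (WittBurnsideRing G A) :=
  TopologicalSpace.induced
    (fun (a : WittBurnsideRing G A) (N : OpenNormalSubgroup G) =>
      Ideal.Quotient.mk (kernelIdeal G A (N : Subgroup G)) a)
    (@Pi.topologicalSpace _ _ fun _ => ⊥)

theorem profinite_isTopologicalAddGroup :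
    @IsTopologicalAddGroup (WittBurnsideRing G A) (profiniteTopology G A) _ := by
  let (N : OpenNormalSubgroup G) :
    TopologicalSpace (WittBurnsideRing G A ⧸ kernelIdeal G A (N : Subgroup G)) := ⊥
  have (N : OpenNormalSubgroup G) :
    DiscreteTopology (WittBurnsideRing G A ⧸ kernelIdeal G A (N : Subgroup G)) := ⟨rfl⟩
  exact topologicalAddGroup_induced
    (RingHom.pi fun N : OpenNormalSubgroup G =>
      Ideal.Quotient.mk (kernelIdeal G A (N : Subgroup G)))

/-- The uniform structure of the additive group with its profinite topology. -/
noncomputable abbrev profiniteUniformSpace : UniformSpace (WittBurnsideRing G A) :=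
  @IsTopologicalAddGroup.rightUniformSpace _ _ (profiniteTopology G A)
    (profinite_isTopologicalAddGroup G A)

end Topology

end WittBurnsideRing

/-! Both topologies have the same shape. The neighbourhoods of `a` are generated by cosets of ideals
of Witt vectors vanishing on a set `P i` of classes that is closed downwards under `≤`, and every
class lies in some `P i`. For initial vanishing these are the classes of bounded size. For the
profinite topology they are the classes on which a given open normal subgroup acts trivially.

The key point is `sub_vanish_iff`: `a - b` vanishes on a lower set exactly when `a` and `b` have the
same coordinates there, although subtraction is not coordinatewise. Over a domain of characteristic
zero, the ghost components over a lower set and the coordinates over it determine each other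
(`ghost_congr`, `eqOn_of_ghost`), and ghost components do subtract componentwise. A general `A` is
reached from the polynomial ring `MvPolynomial A ℤ` through `cover A`.

Being close therefore means agreeing on all coordinates in some `P i`. Distinct vectors differ at a
class lying in some `P i`, so they are separated. Along a Cauchy filter the coordinates in each `P
i` are eventually constant. Since every family of coordinates is a Witt vector, these eventual
values form a vector, and it is the limit. This is `t2Space_and_completeSpace_of_nhds`; what remains
is to identify the two neighbourhood filters. -/

namespace WittBurnside

/-! ### Open normal subgroups, and ghost components on lower sets -/

/-- An open normal subgroup of `G` that acts trivially on a given finite transitive `G`-set. -/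
theorem Frame.exists_openNormalSubgroup {G : Type*} [Group G] [TopologicalSpace G]
    [IsTopologicalGroup G] [CompactSpace G] (T : Frame G) :
    ∃ N : OpenNormalSubgroup G, ∀ g ∈ (N : Subgroup G), ∀ x : T.set, g • x = x := by
  set H : OpenSubgroup G := Quotient.out T
  have : Finite (G ⧸ (H : Subgroup G)) := Frame.finite_set T
  have : (H : Subgroup G).FiniteIndex := Subgroup.finiteIndex_of_finite_quotient
  -- The stabilizer `H` of the base point has finite index, hence so does its normal core. The core
  -- is also closed, as an intersection of conjugates of a closed subgroup, and a closed subgroup of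
  -- finite index is open.
  refine ⟨⟨⟨(H : Subgroup G).normalCore, Subgroup.isOpen_of_isClosed_of_finiteIndex _
    (Subgroup.normalCore_isClosed _ H.isClosed)⟩, Subgroup.normalCore_normal _⟩, fun g hg x => ?_⟩
  obtain ⟨y, rfl⟩ := QuotientGroup.mk_surjective x
  change (QuotientGroup.mk (g * y) : T.set) = QuotientGroup.mk y
  rw [eq_comm, QuotientGroup.eq]
  -- An element of the core has all its conjugates in `H`. Conjugating by `y⁻¹` is what fixing the
  -- coset of `y` requires.
  have h : y⁻¹ * g * y⁻¹⁻¹ ∈ (H : Subgroup G) := hg y⁻¹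
  rwa [inv_inv, mul_assoc] at h

theorem ghost_congr {G : Type*} [Group G] [TopologicalSpace G] [IsTopologicalGroup G]
    [CompactSpace G] {R : Type*} [CommRing R] {a b : Frame G → R} {T : Frame G}
    (h : ∀ U, U ≤ T → a U = b U) : ghost a T = ghost b T :=
  Finset.sum_congr rfl fun U hU => by rw [h U (Frame.mem_below.mp hU)]

/-- Coordinates of an integral Witt vector on a lower set are determined by its ghost components
there. -/
theorem eqOn_of_ghost {G : Type*} [Group G] [TopologicalSpace G] [IsTopologicalGroup G]
    [CompactSpace G] {R : Type*} [CommRing R] [IsDomain R] [CharZero R] {P : Frame G → Prop}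
    (hP : ∀ U T, U ≤ T → P T → P U) {a b : Frame G → R}
    (h : ∀ T, P T → ghost a T = ghost b T) : ∀ T, P T → a T = b T := by
  classical
  intro T
  induction hn : T.size using Nat.strong_induction_on generalizing T with
  | _ n ih =>
  subst hn
  intro hT
  have h1 := h T hT
  -- The terms with `U < T` agree by induction, because `P` is a lower set. Only the linear term
  -- `φ_T(T) X_T` remains, and its positive integer coefficient cancels in a domain of
  -- characteristic zero.
  rw [ghost_eq, ghost_eq, Finset.sum_congr rfl fun U hU => by
    rw [ih _ (Frame.size_lt_of_mem_erase hU) U rfl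
      (hP U T (Frame.mem_below.mp (Finset.mem_of_mem_erase hU)) hT)]] at h1
  exact mul_left_cancel₀ (Nat.cast_ne_zero.mpr T.mapCard_self_pos.ne') (add_left_cancel h1)

end WittBurnside

namespace WittBurnsideRing

open WittBurnside Filter Topology

variable {G : Type*} [Group G] [TopologicalSpace G] {A : Type*} [CommRing A]

/-! ### Cosets of vanishing ideals as agreement of coordinates -/

/-- Coordinatewise lift along `cover A`. -/
noncomputable def lift (a : WittBurnsideRing G A) : WittBurnsideRing G (MvPolynomial A ℤ) :=
  ⟨fun T => MvPolynomial.X (a.coeff T)⟩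

theorem mapFun_lift (a : WittBurnsideRing G A) : mapFun (cover A) (lift a) = a := by
  ext T
  change cover A (MvPolynomial.X (a.coeff T)) = _
  simp [cover]

variable [IsTopologicalGroup G] [CompactSpace G]

/-- The identity is checked on ghost components over a polynomial ring, then pushed down by `cover
A`. The two directions need different lifts. From left to right, the difference must be lifted so
that its zero coordinates stay zero (`exists_lift`). From right to left, equal coordinates must have
equal lifts, which `lift` ensures by sending a coordinate to the variable it names. -/
theorem sub_vanish_iff {P : Frame G → Prop} (hP : ∀ U T, U ≤ T → P T → P U)
    {a b : WittBurnsideRing G A} :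
    (∀ T, P T → (a - b).coeff T = 0) ↔ ∀ T, P T → a.coeff T = b.coeff T := by
  constructor
  · intro h T hT
    obtain ⟨c, hc, hc'⟩ := exists_lift (a - b)
    -- `a` is lifted as a lift of `b` plus the lift `c` of the difference. The ghost components of
    -- `c` vanish on `P`, so this lift has the ghost components of `lift b` there.
    have e : a = mapFun (cover A) (lift b + c) := by
      rw [mapFun_add, mapFun_lift, hc, add_sub_cancel]
    have h1 : (lift b + c).coeff T = (lift b).coeff T := by
      refine eqOn_of_ghost hP (fun U hU => ?_) T hT
      rw [ghost_add, ghost_of_vanish c.coeff _ fun V hV => hc' V (h V (hP V U hV hU)), add_zero]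
    conv_rhs => rw [← mapFun_lift b]
    rw [e]
    exact congrArg (cover A) h1
  · intro h T hT
    have h1 : (lift a + -lift b).coeff T = 0 := by
      refine vanish_of_ghost hP _ (fun U hU => ?_) T hT
      have h2 : ghost (lift a).coeff U = ghost (lift b).coeff U :=
        ghost_congr fun V hV => congrArg MvPolynomial.X (h V (hP V U hV hU))
      rw [ghost_add, ghost_neg, h2, add_neg_cancel]
    rw [sub_eq_add_neg, ← mapFun_lift a, ← mapFun_lift b, ← mapFun_neg, ← mapFun_add]
    exact (congrArg (cover A) h1).trans (map_zero _)

/-! ### The Hausdorff property and completeness -/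

/-- A group topology on the Witt-Burnside ring whose neighbourhoods are given by agreement on
members of a family of lower sets covering the frame is Hausdorff and complete. -/
theorem t2Space_and_completeSpace_of_nhds {ι : Type*} {P : ι → Frame G → Prop}
    (hP : ∀ i U T, U ≤ T → P i T → P i U) (hcover : ∀ T, ∃ i, P i T)
    (t : TopologicalSpace (WittBurnsideRing G A)) (ht : IsTopologicalAddGroup (WittBurnsideRing G A))
    (hnhds : ∀ a, 𝓝 a = ⨅ i, 𝓟 {b : WittBurnsideRing G A | ∀ T, P i T → (b - a).coeff T = 0}) :
    T2Space (WittBurnsideRing G A) ∧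
      @CompleteSpace _ (IsTopologicalAddGroup.rightUniformSpace (WittBurnsideRing G A)) := by
  have hmem : ∀ i (a : WittBurnsideRing G A),
      {b : WittBurnsideRing G A | ∀ T, P i T → (b - a).coeff T = 0} ∈ 𝓝 a := fun i a => by
    rw [hnhds]
    exact mem_iInf_of_mem i (mem_principal_self _)
  constructor
  · rw [t2Space_iff_disjoint_nhds]
    intro a b hab
    obtain ⟨T, hT⟩ : ∃ T, a.coeff T ≠ b.coeff T := by
      by_contra! h
      exact hab (WittBurnsideRing.ext (funext h))
    obtain ⟨i, hi⟩ := hcover T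
    refine disjoint_of_disjoint_of_mem (Set.disjoint_left.mpr fun c hca hcb => hT ?_)
      (hmem i a) (hmem i b)
    rw [← (sub_vanish_iff (hP i)).mp hca T hi, (sub_vanish_iff (hP i)).mp hcb T hi]
  · let := IsTopologicalAddGroup.rightUniformSpace (WittBurnsideRing G A)
    refine ⟨fun {F} hF => ?_⟩
    have hNe : F.NeBot := hF.1
    -- The Cauchy condition, read through `sub_vanish_iff`: some member of `F` consists of vectors
    -- sharing all their coordinates in `P i`.
    have hsmall : ∀ i, ∃ S ∈ F, ∀ x ∈ S, ∀ y ∈ S, ∀ T, P i T → y.coeff T = x.coeff T := by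
      intro i
      have hU : {p : WittBurnsideRing G A × WittBurnsideRing G A |
          ∀ T, P i T → (p.2 - p.1).coeff T = 0} ∈ uniformity (WittBurnsideRing G A) := by
        rw [uniformity_eq_comap_nhds_zero']
        -- Entourages are pulled back along `p.2 - p.1` from neighbourhoods of `0`. The basic
        -- neighbourhood of `0` is phrased with `b - 0`, hence the `sub_zero` below.
        refine ⟨_, hmem i 0, fun p hp T hT => ?_⟩
        have := hp T hT
        rwa [sub_zero] at this
      obtain ⟨S, hS, h⟩ := (cauchy_iff.mp hF).2 _ hU
      refine ⟨S, hS, fun x hx y hy => (sub_vanish_iff (hP i)).mp ?_⟩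
      have hxy := h (Set.mk_mem_prod hx hy)
      rwa [Set.mem_ofPred_eq] at hxy
    choose S hS hSeq using hsmall
    choose s hs using fun i => hF.1.nonempty_of_mem (hS i)
    choose j hj using hcover
    -- The limit takes its `T`-coordinate from a sample vector in the small set for `j T`, an index
    -- whose lower set contains `T`.
    refine ⟨⟨fun T => (s (j T)).coeff T⟩, ?_⟩
    rw [hnhds, le_iInf_iff]
    intro i
    rw [le_principal_iff]
    filter_upwards [hS i] with x hx
    refine (sub_vanish_iff (hP i)).mpr fun T hT => ?_
    -- The indices `i` and `j T` may be unrelated. A common point `z` of their two small sets links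
    -- `x` to the sample at coordinate `T`.
    obtain ⟨z, hz, hz'⟩ := hF.1.nonempty_of_mem (inter_mem (hS i) (hS (j T)))
    exact (hSeq i z hz x hx T hT).trans (hSeq (j T) _ (hs _) z hz' T (hj T))

/-! ### Neighbourhood filters of the two topologies -/

/-- One inequality holds because cosets of `I_n` with `n ≥ 1` are open, the other by the definition
of an open set. The shift to `n + 1` lets the index run over all of `ℕ` while respecting `n ≥ 1`. -/
theorem nhds_initialVanishing (a : WittBurnsideRing G A) :
    @nhds _ (initialVanishingTopology G A) a = ⨅ n : ℕ,
      𝓟 {b : WittBurnsideRing G A | ∀ T : Frame G, T.size < n + 1 → (b - a).coeff T = 0} := by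
  let := initialVanishingTopology G A
  refine le_antisymm (le_iInf fun n => ?_) fun O hO => ?_
  · rw [le_principal_iff]
    refine (initialVanishing_isOpen_coset G A a (n + 1) n.succ_pos).mem_nhds ?_
    change a - a ∈ initialIdeal G A (n + 1)
    rw [sub_self]
    exact Ideal.zero_mem _
  · obtain ⟨O', hO', hopen, ha⟩ := mem_nhds_iff.mp hO
    obtain ⟨n, -, h⟩ := hopen a ha
    refine mem_iInf_of_mem n (mem_principal.mpr fun b hb => hO' ?_)
    -- Openness supplies a coset of `I_n`, which contains the coset of `I_{n+1}` indexed by `n`.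
    have := h (b - a) fun T hT => hb T (hT.trans n.lt_succ_self)
    rwa [add_sub_cancel] at this

/-- In a product of discrete spaces the neighbourhood filter is the infimum of the pullbacks of the
principal filters at the components. The pullback at `N` is the fibre of the quotient map through
`a`, that is, a coset of `K_N`. -/
theorem nhds_profinite (a : WittBurnsideRing G A) :
    @nhds _ (profiniteTopology G A) a = ⨅ N : OpenNormalSubgroup G,
      𝓟 {b : WittBurnsideRing G A | ∀ T : Frame G,
        (∀ g ∈ (N : Subgroup G), ∀ x : T.set, g • x = x) → (b - a).coeff T = 0} := by
  let (N : OpenNormalSubgroup G) :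
    TopologicalSpace (WittBurnsideRing G A ⧸ kernelIdeal G A (N : Subgroup G)) := ⊥
  have (N : OpenNormalSubgroup G) :
    DiscreteTopology (WittBurnsideRing G A ⧸ kernelIdeal G A (N : Subgroup G)) := ⟨rfl⟩
  rw [nhds_induced, nhds_pi, Filter.pi, comap_iInf]
  refine iInf_congr fun N => ?_
  rw [comap_comap, nhds_discrete, ← principal_singleton, comap_principal]
  congr 1
  ext b
  exact Ideal.Quotient.eq

end WittBurnsideRing

theorem mainTheorem10 (G : Type*) [Group G] [TopologicalSpace G] [IsTopologicalGroup G]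
    [CompactSpace G] [TotallyDisconnectedSpace G] (A : Type*) [CommRing A] :
    (@T2Space (WittBurnsideRing G A) (WittBurnsideRing.initialVanishingTopology G A) ∧
      @CompleteSpace (WittBurnsideRing G A) (WittBurnsideRing.initialVanishingUniformSpace G A)) ∧
    (@T2Space (WittBurnsideRing G A) (WittBurnsideRing.profiniteTopology G A) ∧
      @CompleteSpace (WittBurnsideRing G A) (WittBurnsideRing.profiniteUniformSpace G A)) := by
  constructor
  · exact WittBurnsideRing.t2Space_and_completeSpace_of_nhds
      (P := fun (n : ℕ) T => T.size < n + 1)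
      (fun _ _ _ h hT => (WittBurnside.Frame.size_le h).trans_lt hT)
      (fun T => ⟨T.size, T.size.lt_succ_self⟩) _
      (WittBurnsideRing.initialVanishing_isTopologicalAddGroup G A)
      WittBurnsideRing.nhds_initialVanishing
  · refine WittBurnsideRing.t2Space_and_completeSpace_of_nhds
      (P := fun (N : OpenNormalSubgroup G) T => ∀ g ∈ (N : Subgroup G), ∀ x : T.set, g • x = x)
      (fun N U T hUT hT g hg x => ?_) (fun T => T.exists_openNormalSubgroup) _
      (WittBurnsideRing.profinite_isTopologicalAddGroup G A) WittBurnsideRing.nhds_profinite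
    -- A `G`-map between transitive `G`-sets is onto, so triviality of the action of `N` passes from
    -- `T` to its image `U`.
    obtain ⟨f⟩ := hUT
    obtain ⟨y, rfl⟩ := WittBurnside.Frame.map_surjective f x
    rw [← map_smul, hT g hg]
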